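/- Let $K$ be a field, $R=K[x_1,\dots,x_n]$ and $\mathfrak m=(x_1,\dots,x_n)$. For a monomial ideal $I\subset R$ let $G(I)$ be its minimal set of monomial generators, let $\operatorname{Ass}(I)$ be the set of associated primes of $R/I$, and let $\operatorname{depth} R/I$ be the supremum of the lengths of $R/I$-regular sequences in $\mathfrak m$. Let $\operatorname{astab}(I)$ (respectively $\operatorname{dstab}(I)$) be the smallest integer $k_0\ge 1$ with $\operatorname{Ass}(I^k)=\operatorname{Ass}(I^{k_0})$ (respectively $\operatorname{depth}R/I^k=\operatorname{depth}R/I^{k_0}$) for all $k\ge k_0$, and put $\operatorname{Ass}^\infty(I)=\operatorname{Ass}(I^{\operatorname{astab}(I)})$. The monomial ideal $I$ is polymatroidal of degree $d$ if all elements of $G(I)$ have degree $d$ and, whenever $u,v\in G(I)$ and $\deg_{x_i}(u)>\deg_{x_i}(v)$, there is $j$ with $\deg_{x_j}(u)<\deg_{x_j}(v)$ and $x_j(u/x_i)\in I$. Let $\mathfrak m_I$ be the prime ideal generated by the variables that divide some element of $G(I)$; thus $\mathfrak m_I=\mathfrak m$ exactly when $I$ is full-supported. Theorem. Let $I\subset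 R$ be a polymatroidal ideal of degree $2$. Then $\operatorname{astab}(I)$ and $\operatorname{dstab}(I)$ exist and $\operatorname{astab}(I)=\operatorname{dstab}(I)$. More precisely: 1. If $\mathfrak m_I\notin\operatorname{Ass}^\infty(I)$, then $\operatorname{astab}(I)=\operatorname{dstab}(I)=1$. 2. If $\mathfrak m_I\in\operatorname{Ass}^\infty(I)$, then there is a largest integer $t\ge 0$ with $\mathfrak m_I\notin\operatorname{Ass}(I^t)$ (where $I^0=R$ and $\operatorname{Ass}(R)=\emptyset$), and $\operatorname{astab}(I)=\operatorname{dstab}(I)=t+1$. -/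

import Mathlib

noncomputable section

namespace Polymatroidal

open MvPolynomial

/-- The depth of a module `M` with respect to an ideal `J`: the supremum of the lengths of the
`M`-regular sequences whose members lie in `J`. -/
def depth {R : Type*} [CommRing R] (J : Ideal R) (M : Type*) [AddCommGroup M] [Module R M] : ℕ∞ :=
  sSup {l : ℕ∞ | ∃ rs : List R,
    (∀ r ∈ rs, r ∈ J) ∧ RingTheory.Sequence.IsRegular M rs ∧ l = (rs.length : ℕ∞)}

variable {K : Type*} [Field K] {n : ℕ}

/-- The graded maximal ideal `𝔪 = (x_1, …, x_n)` of `K[x_1, …, x_n]`. -/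
def maxIdeal (K : Type*) [Field K] (n : ℕ) : Ideal (MvPolynomial (Fin n) K) :=
  Ideal.span (Set.range X)

/-- A monomial ideal is an ideal generated by monomials. -/
def IsMonomialIdeal (I : Ideal (MvPolynomial (Fin n) K)) : Prop :=
  ∃ S : Set (Fin n →₀ ℕ), I = Ideal.span ((fun a => monomial a (1 : K)) '' S)

/-- The exponent vectors of the monomials in `G(I)`, the set of monomials of `I` that are minimal
with respect to divisibility. -/
def minGens (I : Ideal (MvPolynomial (Fin n) K)) : Set (Fin n →₀ ℕ) :=
  {a | Minimal (fun b => monomial b (1 : K) ∈ I) a}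

/-- `I` is a polymatroidal ideal generated in degree `d`: a monomial ideal whose minimal monomial
generators all have degree `d` and satisfy the exchange property. -/
structure IsPolymatroidal (I : Ideal (MvPolynomial (Fin n) K)) (d : ℕ) : Prop where
  isMonomialIdeal : IsMonomialIdeal I
  degree_eq : ∀ u ∈ minGens I, u.degree = d
  exchange : ∀ u ∈ minGens I, ∀ v ∈ minGens I, ∀ i, v i < u i →
    ∃ j, u j < v j ∧ monomial (u - Finsupp.single i 1 + Finsupp.single j 1) (1 : K) ∈ I

/-- `supp(I)`: the (indices of the) variables that divide some minimal monomial generator. -/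
def supp (I : Ideal (MvPolynomial (Fin n) K)) : Set (Fin n) :=
  {i | ∃ u ∈ minGens I, u i ≠ 0}

/-- The monomial prime ideal generated by the variables in `supp(I)`. It equals `𝔪` if and only if
`I` is full-supported. -/
def suppIdeal (I : Ideal (MvPolynomial (Fin n) K)) : Ideal (MvPolynomial (Fin n) K) :=
  Ideal.span (X '' supp I)

/-- `Ass(I)`: the set of associated primes of `R/I`. -/
def Ass (I : Ideal (MvPolynomial (Fin n) K)) : Set (Ideal (MvPolynomial (Fin n) K)) :=
  associatedPrimes (MvPolynomial (Fin n) K) (MvPolynomial (Fin n) K ⧸ I)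

/-- The depth of `R/I` with respect to `𝔪`. -/
def depthQuot (I : Ideal (MvPolynomial (Fin n) K)) : ℕ∞ :=
  depth (maxIdeal K n) (MvPolynomial (Fin n) K ⧸ I)

/-- The positive integers from which on `Ass(I^k)` is constant. -/
def assStable (I : Ideal (MvPolynomial (Fin n) K)) : Set ℕ :=
  {k₀ | 1 ≤ k₀ ∧ ∀ k, k₀ ≤ k → Ass (I ^ k) = Ass (I ^ k₀)}

/-- The positive integers from which on `depth R/I^k` is constant. -/
def depthStable (I : Ideal (MvPolynomial (Fin n) K)) : Set ℕ :=
  {k₀ | 1 ≤ k₀ ∧ ∀ k, k₀ ≤ k → depthQuot (I ^ k) = depthQuot (I ^ k₀)}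

/-- The index of Ass-stability of `I`. -/
def astab (I : Ideal (MvPolynomial (Fin n) K)) : ℕ := sInf (assStable I)

/-- The index of depth stability of `I`. -/
def dstab (I : Ideal (MvPolynomial (Fin n) K)) : ℕ := sInf (depthStable I)

/-- The stable set `Ass^∞(I)` of associated primes of the powers of `I`. -/
def assInfty (I : Ideal (MvPolynomial (Fin n) K)) : Set (Ideal (MvPolynomial (Fin n) K)) :=
  Ass (I ^ astab I)

end Polymatroidal

end

/-!
Write `T = supp I`, call `i` and `j` adjacent if `x_i x_j ∈ I`, let `N(c)` be the set of
neighbours of `c`, and let `P_A` be the prime generated by the variables in `A`. The exchange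
property says that every vertex in `T` is adjacent to one end of any given edge
(`IsPolymatroidal.adj_or_adj`). So adjacency is that of a complete multipartite graph on `T` in
which singleton parts may carry loops, and the part of a loopless vertex `c` is `T \ N(c)`.

Splitting edges off a monomial greedily gives the decomposition `I ^ k = P_T ^ (2k) ∩ ⋂_{c ∈ T}
P_{N(c)} ^ k` (`IsPolymatroidal.pow_eq`). Powers of monomial primes are primary, so the associated
primes of `I ^ k` are among `P_T` and the `P_{N(c)}`. For loopless `c` the prime `P_{N(c)}`
belongs to `Ass (I ^ k)` for every `k ≥ 1`, so that only the membership of `P_T` can depend on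
`k`:
* if `T` is empty or there is a loop, a socle monomial shows `P_T ∈ Ass (I ^ k)` for all `k ≥ 1`;
* without loops but with a triangle (at least three parts), there is a socle monomial exactly for
  `k ≥ 2`, whereas `P_T ^ 2` is redundant in the decomposition of `I`;
* without loops and triangles (two parts), `P_T ^ (2k)` is redundant for every `k`.

For the depth, the variables outside `T` form a regular sequence on `R / I ^ k`. If there is a
socle monomial, this sequence is a longest one, because by the Rees theorem a regular sequence is
of maximal length as soon as the quotient by it has a nonzero element killed by `𝔪`
(`length_le_of_smul_eq_zero`); so the depth is `n - |T|`. If `P_T ^ (2k)` is redundant, a form in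
the variables of `T` outside all `P_{N(c)}` prolongs the sequence, so the depth is larger; in the
case of two parts the prolonged sequence is maximal and the depth is `n - |T| + 1` for every `k`.
Hence the depth changes at the same power as `Ass`.
-/

noncomputable section

namespace Polymatroidal

open MvPolynomial

/-! ### Lengths of regular sequences -/

section Depth

open RingTheory.Sequence CategoryTheory Abelian
open scoped Pointwise

universe u

lemma smul_top_quotSMulTop_eq_top_iff {R M : Type*} [CommRing R] [AddCommGroup M] [Module R M]
    {J : Ideal R} {y : R} (hyJ : y ∈ J) :
    J • (⊤ : Submodule R (QuotSMulTop y M)) = ⊤ ↔ J • (⊤ : Submodule R M) = ⊤ := by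
  have hle : y • (⊤ : Submodule R M) ≤ J • ⊤ := by
    rw [← Submodule.ideal_span_singleton_smul]
    exact Submodule.smul_mono_left ((Ideal.span_singleton_le_iff_mem J).mpr hyJ)
  have h := Submodule.comap_smul_top_of_surjective J
    (Submodule.mkQ (y • (⊤ : Submodule R M))) (Submodule.mkQ_surjective _)
  rw [Submodule.ker_mkQ, sup_eq_left.2 hle] at h
  rw [← h]
  exact ⟨fun h => by rw [h, Submodule.comap_top], fun h => Submodule.comap_injective_of_surjective
    (Submodule.mkQ_surjective _) (by rw [h, Submodule.comap_top])⟩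

/-- Dimension shifting: dividing out one regular element shortens the longest regular sequence by
at most one, whatever the element. This is where the Rees theorem enters. -/
lemma exists_isRegular_quotSMulTop {R : Type u} [CommRing R] [IsNoetherianRing R] (J : Ideal R)
    (M : Type u) [AddCommGroup M] [Module R M] [Module.Finite R M]
    {y : R} (hyJ : y ∈ J) (hy : IsSMulRegular M y)
    (hJ : J • (⊤ : Submodule R (QuotSMulTop y M)) ≠ ⊤) {e : ℕ}
    (h : ∃ rs : List R, rs.length = e + 1 ∧ (∀ r ∈ rs, r ∈ J) ∧ IsRegular M rs) :
    ∃ rs : List R, rs.length = e ∧ (∀ r ∈ rs, r ∈ J) ∧ IsRegular (QuotSMulTop y M) rs := by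
  have hJM : J • (⊤ : Submodule R M) < ⊤ :=
    lt_top_iff_ne_top.2 fun hM => hJ ((smul_top_quotSMulTop_eq_top_iff hyJ).2 hM)
  have h1 := ((ModuleCat.exists_isRegular_tfae J (e + 1) (ModuleCat.of R M) hJM).out 3 1).1 h
  refine ((ModuleCat.exists_isRegular_tfae J e (ModuleCat.of R (QuotSMulTop y M))
    hJ.lt_top).out 3 1).2 fun i hi => ?_
  have zero1 := AddCommGrpCat.isZero_of_iff_subsingleton.mpr (h1 i (by omega))
  have zero2 := AddCommGrpCat.isZero_of_iff_subsingleton.mpr (h1 (i + 1) (by omega))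
  exact AddCommGrpCat.subsingleton_of_isZero <| ShortComplex.Exact.isZero_of_both_zeros
    ((Ext.covariant_sequence_exact₃' _
      (IsSMulRegular.smulShortComplex_shortExact (M := ModuleCat.of R M) hy)) i (i + 1) rfl)
    (zero1.eq_zero_of_src _) (zero2.eq_zero_of_tgt _)

/-- If `M / (ys) M` has a nonzero element killed by `J`, then `ys` is a longest `M`-regular
sequence in `J`. -/
lemma length_le_of_smul_eq_zero {R : Type u} [CommRing R] [IsNoetherianRing R] (J : Ideal R)
    (ys : List R) (hysJ : ∀ r ∈ ys, r ∈ J) (M : Type u) [AddCommGroup M] [Module R M]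
    [Module.Finite R M] (hys : IsRegular M ys) (hJ : J • (⊤ : Submodule R M) ≠ ⊤)
    (z : M ⧸ (Ideal.ofList ys • ⊤ : Submodule R M)) (hz : z ≠ 0) (hJz : ∀ r ∈ J, r • z = 0)
    (xs : List R) (hxsJ : ∀ r ∈ xs, r ∈ J) (hxs : IsRegular M xs) :
    xs.length ≤ ys.length := by
  induction ys generalizing M xs with
  | nil =>
    rcases xs with _ | ⟨x, xs⟩
    · simp
    · exfalso
      obtain ⟨z, rfl⟩ := Submodule.mkQ_surjective _ z
      have hx := ((isRegular_cons_iff M x xs).1 hxs).1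
      have h0 := hJz x (hxsJ x (by simp))
      rw [← map_smul] at h0
      simp only [Submodule.mkQ_apply, Submodule.Quotient.mk_eq_zero, Ideal.ofList_nil,
        Submodule.bot_smul, Submodule.mem_bot, ne_eq] at h0 hz
      exact hz (hx (by simpa using h0))
  | cons y ys ih =>
    rcases xs with _ | ⟨x, xs⟩
    · simp
    · have hy := (isRegular_cons_iff M y ys).1 hys
      have hJ' : J • (⊤ : Submodule R (QuotSMulTop y M)) ≠ ⊤ := fun h =>
        hJ ((smul_top_quotSMulTop_eq_top_iff (hysJ y (by simp))).1 h)
      obtain ⟨rs, hrs, hrsJ, hreg⟩ := exists_isRegular_quotSMulTop J M (hysJ y (by simp)) hy.1 hJ'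
        ⟨x :: xs, List.length_cons, hxsJ, hxs⟩
      have := ih (fun r hr => hysJ r (by simp [hr])) (QuotSMulTop y M) hy.2 hJ'
        (Submodule.quotOfListConsSMulTopEquivQuotSMulTopInner M y ys z) (by simpa using hz)
        (fun r hr => by rw [← map_smul, hJz r hr, map_zero]) rs hrsJ hreg
      simp only [List.length_cons]
      omega

/-- Elements of the iterated quotient `(R / Q) / J (R / Q)` vanish exactly on `Q + J`. -/
lemma mk_mem_smul_top_iff {R : Type*} [CommRing R] (Q J : Ideal R) (f : R) :
    (Submodule.Quotient.mk f : R ⧸ Q) ∈ (J • ⊤ : Submodule R (R ⧸ Q)) ↔ f ∈ Q ⊔ J := by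
  have := Submodule.comap_smul_top_of_surjective J (Submodule.mkQ Q) (Submodule.mkQ_surjective _)
  rw [Submodule.ker_mkQ, smul_eq_mul, Ideal.mul_top, sup_comm] at this
  exact (SetLike.ext_iff.1 this f)

lemma isWeaklyRegular_quotient_iff {R : Type*} [CommRing R] (Q : Ideal R) (rs : List R) :
    IsWeaklyRegular (R ⧸ Q) rs ↔ ∀ (i : ℕ) (h : i < rs.length), ∀ f,
      rs[i] * f ∈ Q ⊔ Ideal.ofList (rs.take i) → f ∈ Q ⊔ Ideal.ofList (rs.take i) := by
  rw [isWeaklyRegular_iff]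
  refine forall₂_congr fun i hi => ?_
  rw [isSMulRegular_iff_right_eq_zero_of_smul]
  constructor
  · intro h f hf
    have := h (Submodule.Quotient.mk (Submodule.Quotient.mk f)) (by
      rw [← Submodule.Quotient.mk_smul, Submodule.Quotient.mk_eq_zero,
        ← Submodule.Quotient.mk_smul, mk_mem_smul_top_iff]
      exact hf)
    rwa [Submodule.Quotient.mk_eq_zero, mk_mem_smul_top_iff] at this
  · intro h z hz
    obtain ⟨z, rfl⟩ := Submodule.mkQ_surjective _ z
    obtain ⟨f, rfl⟩ := Submodule.mkQ_surjective _ z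
    simp only [Submodule.mkQ_apply] at hz ⊢
    rw [← Submodule.Quotient.mk_smul, Submodule.Quotient.mk_eq_zero,
        ← Submodule.Quotient.mk_smul, mk_mem_smul_top_iff] at hz
    rw [Submodule.Quotient.mk_eq_zero, mk_mem_smul_top_iff]
    exact h f hz

lemma isRegular_quotient {R : Type*} [CommRing R] {Q J : Ideal R} (hQ : Q ≤ J) (hJ : J ≠ ⊤)
    {rs : List R} (hrs : ∀ r ∈ rs, r ∈ J) (h : IsWeaklyRegular (R ⧸ Q) rs) :
    IsRegular (R ⧸ Q) rs := by
  refine ⟨h, fun htop => hJ ((Ideal.eq_top_iff_one J).2 ?_)⟩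
  have h1 : (Submodule.Quotient.mk 1 : R ⧸ Q) ∈ (Ideal.ofList rs • ⊤ : Submodule R (R ⧸ Q)) :=
    htop ▸ Submodule.mem_top
  rw [mk_mem_smul_top_iff] at h1
  exact sup_le hQ (Ideal.span_le.2 hrs) h1

lemma length_le_depth {R : Type*} [CommRing R] {Q J : Ideal R} (hQ : Q ≤ J) (hJ : J ≠ ⊤)
    {rs : List R} (hrs : ∀ r ∈ rs, r ∈ J) (h : IsWeaklyRegular (R ⧸ Q) rs) :
    (rs.length : ℕ∞) ≤ depth J (R ⧸ Q) :=
  le_sSup ⟨rs, hrs, isRegular_quotient hQ hJ hrs h, rfl⟩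

/-- The depth of `R / Q` is the length of any regular sequence `rs` for which `R / (Q + (rs))` has
a nonzero element killed by `J`. -/
lemma depth_quotient_eq_length {R : Type u} [CommRing R] [IsNoetherianRing R] {Q J : Ideal R}
    (hQ : Q ≤ J) (hJ : J ≠ ⊤) {rs : List R} (hrs : ∀ r ∈ rs, r ∈ J)
    (h : IsWeaklyRegular (R ⧸ Q) rs) {f : R} (hf : f ∉ Q ⊔ Ideal.ofList rs)
    (hJf : ∀ r ∈ J, r * f ∈ Q ⊔ Ideal.ofList rs) :
    depth J (R ⧸ Q) = rs.length := by
  refine le_antisymm (sSup_le ?_) (length_le_depth hQ hJ hrs h)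
  rintro _ ⟨xs, hxs, hreg, rfl⟩
  refine Nat.cast_le.2 (length_le_of_smul_eq_zero J rs hrs (R ⧸ Q)
    (isRegular_quotient hQ hJ hrs h) ?_
    (Submodule.Quotient.mk (Submodule.Quotient.mk f)) ?_ ?_ xs hxs hreg)
  · intro htop
    have h1 : (Submodule.Quotient.mk 1 : R ⧸ Q) ∈ (J • ⊤ : Submodule R (R ⧸ Q)) := by
      rw [htop]
      exact Submodule.mem_top
    rw [mk_mem_smul_top_iff, sup_eq_right.2 hQ] at h1
    exact hJ ((Ideal.eq_top_iff_one J).2 h1)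
  · rwa [Ne, Submodule.Quotient.mk_eq_zero, mk_mem_smul_top_iff]
  · intro r hr
    rw [← Submodule.Quotient.mk_smul, Submodule.Quotient.mk_eq_zero,
        ← Submodule.Quotient.mk_smul, mk_mem_smul_top_iff]
    exact hJf r hr

end Depth

/-! ### Powers of monomial primes -/

section MonomialPrime

variable {K : Type*} [Field K] {n : ℕ}

/-- The monomial prime ideal generated by the variables `x_i` with `i ∈ A`. -/
def varIdeal (K : Type*) [Field K] {n : ℕ} (A : Finset (Fin n)) : Ideal (MvPolynomial (Fin n) K) :=
  Ideal.span (X '' (A : Set (Fin n)))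

/-- The homomorphism `x_i ↦ x_i t` for `i ∈ A`, `x_i ↦ x_i` otherwise, into `K[x_1, …, x_n][t]`.
The powers of `varIdeal K A` are the preimages of the powers of the prime element `t`. -/
def gradingHom (K : Type*) [Field K] {n : ℕ} (A : Finset (Fin n)) :
    MvPolynomial (Fin n) K →ₐ[K] Polynomial (MvPolynomial (Fin n) K) :=
  aeval fun i => if i ∈ A then Polynomial.C (X i) * Polynomial.X else Polynomial.C (X i)

lemma gradingHom_monomial (A : Finset (Fin n)) (a : Fin n →₀ ℕ) (c : K) :
    gradingHom K A (monomial a c) =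
      Polynomial.C (monomial a c) * Polynomial.X ^ (∑ i ∈ A, a i) := by
  have hC : (algebraMap K (Polynomial (MvPolynomial (Fin n) K))) c =
      Polynomial.C (C c) := rfl
  rw [gradingHom, aeval_monomial, Finsupp.prod_fintype _ _ (by simp), monomial_eq,
    Finsupp.prod_fintype _ _ (by simp), hC, map_mul, mul_assoc, map_prod]
  congr 1
  have : ∑ i ∈ A, a i = ∑ i, if i ∈ A then a i else 0 := by simp
  rw [this, ← Finset.prod_pow_eq_pow_sum, ← Finset.prod_mul_distrib]
  refine Finset.prod_congr rfl fun i _ => ?_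
  split_ifs <;> simp [mul_pow]

lemma coeff_gradingHom (A : Finset (Fin n)) (f : MvPolynomial (Fin n) K) (a : Fin n →₀ ℕ) (d : ℕ) :
    coeff a ((gradingHom K A f).coeff d) = if ∑ i ∈ A, a i = d then coeff a f else 0 := by
  induction f using MvPolynomial.induction_on' with
  | monomial b c =>
    rw [gradingHom_monomial, Polynomial.coeff_C_mul_X_pow]
    by_cases hab : b = a
    · subst hab
      by_cases h : d = ∑ i ∈ A, b i
      · simp [h]
      · simp [h, Ne.symm h]
    · by_cases h : d = ∑ i ∈ A, b i <;> simp [h, coeff_monomial, hab]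
  | add p q hp hq =>
    rw [map_add, Polynomial.coeff_add, coeff_add, hp, hq, coeff_add]
    split_ifs <;> simp

lemma X_pow_dvd_gradingHom_iff (A : Finset (Fin n)) (f : MvPolynomial (Fin n) K) (k : ℕ) :
    Polynomial.X ^ k ∣ gradingHom K A f ↔ ∀ a ∈ f.support, k ≤ ∑ i ∈ A, a i := by
  rw [Polynomial.X_pow_dvd_iff]
  constructor
  · intro h a ha
    by_contra! hlt
    have := coeff_gradingHom A f a (∑ i ∈ A, a i)
    rw [h _ hlt, if_pos rfl, coeff_zero] at this
    exact mem_support_iff.1 ha this.symm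
  · intro h d hd
    ext a
    rw [coeff_gradingHom, coeff_zero]
    split_ifs with hda
    · by_contra hne
      have := h a (mem_support_iff.2 hne)
      omega
    · rfl

lemma X_mem_varIdeal {A : Finset (Fin n)} {i : Fin n} (hi : i ∈ A) :
    (X i : MvPolynomial (Fin n) K) ∈ varIdeal K A :=
  Ideal.subset_span ⟨i, hi, rfl⟩

lemma monomial_mem_varIdeal_pow (A : Finset (Fin n)) (k : ℕ) (a : Fin n →₀ ℕ) (c : K)
    (h : k ≤ ∑ i ∈ A, a i) : monomial a c ∈ varIdeal K A ^ k := by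
  induction k generalizing a with
  | zero => simp
  | succ k ih =>
    obtain ⟨i, hiA, hi⟩ := Finset.exists_ne_zero_of_sum_ne_zero (by omega : ∑ i ∈ A, a i ≠ 0)
    have hle : Finsupp.single i 1 ≤ a := by
      rw [Finsupp.single_le_iff]; omega
    obtain ⟨b, rfl⟩ := exists_add_of_le hle
    have hs : ∑ j ∈ A, (Finsupp.single i 1 + b : Fin n →₀ ℕ) j = 1 + ∑ j ∈ A, b j := by
      simp [Finset.sum_add_distrib, Finsupp.single_apply, hiA]
    rw [add_comm _ b, monomial_add_single, pow_one, pow_succ]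
    exact Ideal.mul_mem_mul (ih b (by omega)) (X_mem_varIdeal hiA)

lemma mem_varIdeal_pow_iff_dvd (A : Finset (Fin n)) (f : MvPolynomial (Fin n) K) (k : ℕ) :
    f ∈ varIdeal K A ^ k ↔ Polynomial.X ^ k ∣ gradingHom K A f := by
  constructor
  · intro h
    have hle : varIdeal K A ≤ Ideal.comap (gradingHom K A) (Ideal.span {Polynomial.X}) := by
      refine Ideal.span_le.2 ?_
      rintro _ ⟨i, hi, rfl⟩
      have hi : i ∈ A := hi
      simp [gradingHom, hi, Ideal.mem_span_singleton]
    have := (Ideal.pow_right_mono hle k).trans (Ideal.le_comap_pow _ k) h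
    rwa [Ideal.mem_comap, Ideal.span_singleton_pow, Ideal.mem_span_singleton] at this
  · intro h
    rw [X_pow_dvd_gradingHom_iff] at h
    rw [f.as_sum]
    exact Ideal.sum_mem _ fun a ha => monomial_mem_varIdeal_pow A k a _ (h a ha)

lemma mem_varIdeal_pow (A : Finset (Fin n)) (f : MvPolynomial (Fin n) K) (k : ℕ) :
    f ∈ varIdeal K A ^ k ↔ ∀ a ∈ f.support, k ≤ ∑ i ∈ A, a i := by
  rw [mem_varIdeal_pow_iff_dvd, X_pow_dvd_gradingHom_iff]

lemma mem_varIdeal (A : Finset (Fin n)) (f : MvPolynomial (Fin n) K) :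
    f ∈ varIdeal K A ↔ ∀ a ∈ f.support, 1 ≤ ∑ i ∈ A, a i := by
  rw [← mem_varIdeal_pow, pow_one]

lemma monomial_mem_varIdeal_pow_iff (A : Finset (Fin n)) (a : Fin n →₀ ℕ) (k : ℕ) :
    monomial a (1 : K) ∈ varIdeal K A ^ k ↔ k ≤ ∑ i ∈ A, a i := by
  classical
  rw [mem_varIdeal_pow, support_monomial, if_neg one_ne_zero]
  simp

lemma X_mem_varIdeal_iff (A : Finset (Fin n)) (i : Fin n) :
    (X i : MvPolynomial (Fin n) K) ∈ varIdeal K A ↔ i ∈ A := by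
  refine ⟨fun h => ?_, X_mem_varIdeal⟩
  rw [← pow_one (varIdeal K A), X, monomial_mem_varIdeal_pow_iff] at h
  by_contra hi
  rw [Finset.sum_eq_zero fun j hj => by
    rw [Finsupp.single_apply, if_neg (by rintro rfl; exact hi hj)]] at h
  omega

lemma varIdeal_injective : Function.Injective (varIdeal K : Finset (Fin n) → _) := fun A B h => by
  ext i
  rw [← X_mem_varIdeal_iff (K := K), h, X_mem_varIdeal_iff]

lemma mem_or_mem_pow_of_mul_mem {A : Finset (Fin n)} {f g : MvPolynomial (Fin n) K} {k : ℕ}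
    (h : f * g ∈ varIdeal K A ^ k) : f ∈ varIdeal K A ^ k ∨ g ∈ varIdeal K A := by
  by_cases hg : g ∈ varIdeal K A
  · exact Or.inr hg
  · left
    rw [mem_varIdeal_pow_iff_dvd, map_mul] at h
    rw [mem_varIdeal_pow_iff_dvd]
    refine Polynomial.prime_X.pow_dvd_of_dvd_mul_right k (fun hd => hg ?_) h
    rw [← pow_one (varIdeal K A), mem_varIdeal_pow_iff_dvd, pow_one]
    exact hd

instance varIdeal_isPrime (A : Finset (Fin n)) : (varIdeal K A).IsPrime where
  ne_top' := by
    rw [Ideal.ne_top_iff_one, ← pow_one (varIdeal K A), ← C_1, C_apply,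
      monomial_mem_varIdeal_pow_iff]
    simp
  mem_or_mem' h := by
    simpa using mem_or_mem_pow_of_mul_mem (k := 1) (by simpa using h)

lemma maxIdeal_eq_varIdeal : maxIdeal K n = varIdeal K Finset.univ := by
  simp [maxIdeal, varIdeal]

lemma maxIdeal_ne_top : maxIdeal K n ≠ ⊤ := by
  rw [maxIdeal_eq_varIdeal]
  exact Ideal.IsPrime.ne_top'

lemma X_mem_maxIdeal (i : Fin n) :
    (X i : MvPolynomial (Fin n) K) ∈ maxIdeal K n :=
  Ideal.subset_span ⟨i, rfl⟩

lemma maxIdeal_mul_mem {Q : Ideal (MvPolynomial (Fin n) K)}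
    {f : MvPolynomial (Fin n) K} (h : ∀ i, X i * f ∈ Q) : ∀ r ∈ maxIdeal K n, r * f ∈ Q := by
  have hle : maxIdeal K n ≤ Q.colon {f} := by
    refine Ideal.span_le.2 ?_
    rintro _ ⟨i, rfl⟩
    exact Submodule.mem_colon_singleton.2 (h i)
  exact fun r hr => Submodule.mem_colon_singleton.1 (hle hr)

/-! ### Associated primes -/

lemma mem_Ass_iff {I P : Ideal (MvPolynomial (Fin n) K)} :
    P ∈ Ass I ↔ P.IsPrime ∧ ∃ f, ∀ g, g ∈ P ↔ g * f ∈ I := by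
  rw [Ass, AssociatedPrimes.mem_iff, isAssociatedPrime_iff]
  refine and_congr_right fun _ => ?_
  have key (f : MvPolynomial (Fin n) K) : P = Submodule.colon ⊥ {Ideal.Quotient.mk I f} ↔
      ∀ g, g ∈ P ↔ g * f ∈ I := by
    rw [SetLike.ext_iff]
    refine forall_congr' fun g => ?_
    rw [Submodule.mem_colon_singleton, Submodule.mem_bot,
      ← Ideal.Quotient.eq_zero_iff_mem (I := I), map_mul]
    rfl
  constructor
  · rintro ⟨x, hx⟩
    obtain ⟨f, rfl⟩ := Ideal.Quotient.mk_surjective x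
    exact ⟨f, (key f).1 hx⟩
  · rintro ⟨f, hf⟩
    exact ⟨_, (key f).2 hf⟩

lemma Ass_top : Ass (⊤ : Ideal (MvPolynomial (Fin n) K)) = ∅ := by
  refine Set.eq_empty_of_forall_notMem fun P hP => ?_
  obtain ⟨hP, f, hf⟩ := mem_Ass_iff.1 hP
  exact hP.one_notMem ((hf 1).2 trivial)

/-- Associated primes of an intersection come from the two members: if `P = ((I ∩ J) : f)` then `P`
is the intersection of `(I : f)` and `(J : f)`, hence equal to one of them. -/
lemma Ass_inf_subset (I J : Ideal (MvPolynomial (Fin n) K)) : Ass (I ⊓ J) ⊆ Ass I ∪ Ass J := by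
  intro P hP
  obtain ⟨hP, f, hf⟩ := mem_Ass_iff.1 hP
  have hcol (Q : Ideal (MvPolynomial (Fin n) K)) (g : MvPolynomial (Fin n) K) :
      g ∈ Q.colon {f} ↔ g * f ∈ Q := Submodule.mem_colon_singleton
  have hle : I.colon {f} ⊓ J.colon {f} ≤ P := fun g hg =>
    (hf g).2 ⟨(hcol I g).1 hg.1, (hcol J g).1 hg.2⟩
  rcases hP.inf_le.1 hle with h | h
  · exact Or.inl (mem_Ass_iff.2 ⟨hP, f, fun g =>
      ⟨fun hg => ((hf g).1 hg).1, fun hg => h ((hcol I g).2 hg)⟩⟩)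
  · exact Or.inr (mem_Ass_iff.2 ⟨hP, f, fun g =>
      ⟨fun hg => ((hf g).1 hg).2, fun hg => h ((hcol J g).2 hg)⟩⟩)

lemma Ass_finset_inf_subset {ι : Type*} (s : Finset ι) (J : ι → Ideal (MvPolynomial (Fin n) K)) :
    Ass (s.inf J) ⊆ ⋃ c ∈ s, Ass (J c) := by
  classical
  induction s using Finset.induction_on with
  | empty => simp [Ass_top]
  | insert c s _ ih =>
    rw [Finset.inf_insert, Finset.set_biUnion_insert]
    exact (Ass_inf_subset _ _).trans (Set.union_subset_union_right _ ih)

lemma Ass_varIdeal_pow_subset (A : Finset (Fin n)) (k : ℕ) :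
    Ass (varIdeal K A ^ k) ⊆ {varIdeal K A} := by
  intro P hP
  obtain ⟨hP, f, hf⟩ := mem_Ass_iff.1 hP
  have hf0 : f ∉ varIdeal K A ^ k := fun h =>
    hP.one_notMem ((hf 1).2 (by rwa [one_mul]))
  refine le_antisymm (fun g hg => ?_) fun g hg => ?_
  · exact (mem_or_mem_pow_of_mul_mem (by rw [mul_comm]; exact (hf g).1 hg)).resolve_left hf0
  · exact hP.mem_of_pow_mem k ((hf _).2 (Ideal.mul_mem_right _ _ (Ideal.pow_mem_pow hg k)))

/-- An element outside all associated primes is a nonzerodivisor modulo the ideal. -/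
lemma mem_of_mul_mem_of_notMem_Ass {I : Ideal (MvPolynomial (Fin n) K)} {y : MvPolynomial (Fin n) K}
    (hy : ∀ P ∈ Ass I, y ∉ P) {f : MvPolynomial (Fin n) K} (h : y * f ∈ I) : f ∈ I := by
  by_contra hf
  have h0 : Ideal.Quotient.mk I f ≠ 0 := by rwa [Ne, Ideal.Quotient.eq_zero_iff_mem]
  obtain ⟨P, hP, hle⟩ := exists_le_isAssociatedPrime_of_isNoetherianRing
    (MvPolynomial (Fin n) K) _ h0
  refine hy P hP (hle ?_)
  rw [Submodule.mem_colon_singleton, Submodule.mem_bot]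
  exact Ideal.Quotient.eq_zero_iff_mem.2 h

end MonomialPrime

/-! ### Ideals that do not involve a variable -/

section FreeOf

variable {K : Type*} [Field K] {n : ℕ}

/-- The ideal `Q` is generated by polynomials that do not involve the variable `x_j`. -/
def FreeOf (j : Fin n) (Q : Ideal (MvPolynomial (Fin n) K)) : Prop :=
  ∃ S : Set (MvPolynomial (Fin n) K), (∀ g ∈ S, j ∉ g.vars) ∧ Q = Ideal.span S

lemma FreeOf.sup {j : Fin n} {Q Q' : Ideal (MvPolynomial (Fin n) K)} (h : FreeOf j Q)
    (h' : FreeOf j Q') : FreeOf j (Q ⊔ Q') := by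
  obtain ⟨S, hS, rfl⟩ := h
  obtain ⟨S', hS', rfl⟩ := h'
  exact ⟨S ∪ S', fun g hg => hg.elim (hS g) (hS' g), (Ideal.span_union S S').symm⟩

lemma FreeOf.mul {j : Fin n} {Q Q' : Ideal (MvPolynomial (Fin n) K)} (h : FreeOf j Q)
    (h' : FreeOf j Q') : FreeOf j (Q * Q') := by
  obtain ⟨S, hS, rfl⟩ := h
  obtain ⟨S', hS', rfl⟩ := h'
  refine ⟨_, ?_, Ideal.span_mul_span' S S'⟩
  rintro _ ⟨g, hg, g', hg', rfl⟩ hj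
  exact (Finset.mem_union.1 (vars_mul g g' hj)).elim (hS g hg) (hS' g' hg')

lemma freeOf_top (j : Fin n) : FreeOf j (⊤ : Ideal (MvPolynomial (Fin n) K)) :=
  ⟨{1}, by simp, by simp⟩

lemma FreeOf.pow {j : Fin n} {Q : Ideal (MvPolynomial (Fin n) K)} (h : FreeOf j Q) (k : ℕ) :
    FreeOf j (Q ^ k) := by
  induction k with
  | zero => simpa using freeOf_top j
  | succ k ih => rw [pow_succ]; exact ih.mul h

lemma freeOf_ofList {j : Fin n} {rs : List (MvPolynomial (Fin n) K)} (h : ∀ r ∈ rs, j ∉ r.vars) :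
    FreeOf j (Ideal.ofList rs) :=
  ⟨{r | r ∈ rs}, h, rfl⟩

lemma apply_eq_zero_of_notMem_vars {j : Fin n} {g : MvPolynomial (Fin n) K} (hj : j ∉ g.vars)
    {a : Fin n →₀ ℕ} (ha : a ∈ g.support) : a j = 0 := by
  by_contra h
  exact hj ((mem_vars_iff_mem_support j).2 ⟨a, ha, Finsupp.mem_support_iff.2 h⟩)

lemma divMonomial_mul_of_notMem_vars {j : Fin n} {g : MvPolynomial (Fin n) K} (hj : j ∉ g.vars)
    (h : MvPolynomial (Fin n) K) :
    (h * g).divMonomial (Finsupp.single j 1) = h.divMonomial (Finsupp.single j 1) * g := by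
  conv_lhs => rw [← divMonomial_add_modMonomial_single h j, add_mul, add_divMonomial, mul_assoc,
    X_mul_divMonomial]
  rw [add_eq_left]
  ext a
  rw [coeff_divMonomial, coeff_zero]
  by_contra hne
  classical
  obtain ⟨p, hp, q, hq, hpq⟩ := Finset.mem_add.1 (support_mul _ _ (mem_support_iff.2 hne))
  have hp0 : p j = 0 := by
    by_contra hpj
    refine mem_support_iff.1 hp (coeff_modMonomial_of_le _ ?_)
    rw [Finsupp.single_le_iff]
    omega
  have := DFunLike.congr_fun hpq j
  simp only [Finsupp.add_apply, hp0, apply_eq_zero_of_notMem_vars hj hq,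
    Finsupp.single_eq_same] at this
  omega

/-- A variable that an ideal does not involve is a nonzerodivisor modulo this ideal. -/
lemma FreeOf.mem_of_X_mul_mem {j : Fin n} {Q : Ideal (MvPolynomial (Fin n) K)} (h : FreeOf j Q)
    {f : MvPolynomial (Fin n) K} (hf : X j * f ∈ Q) : f ∈ Q := by
  obtain ⟨S, hS, rfl⟩ := h
  have key (g : MvPolynomial (Fin n) K) (hg : g ∈ Ideal.span S) : ∀ b : MvPolynomial (Fin n) K,
      (b * g).divMonomial (Finsupp.single j 1) ∈ Ideal.span S := by
    induction hg using Submodule.span_induction with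
    | mem g hg =>
      intro b
      rw [divMonomial_mul_of_notMem_vars (hS g hg)]
      exact Ideal.mul_mem_left _ _ (Ideal.subset_span hg)
    | zero => simp [zero_divMonomial]
    | add g g' _ _ hg hg' =>
      intro b
      rw [mul_add, add_divMonomial]
      exact add_mem (hg b) (hg' b)
    | smul c g _ hg =>
      intro b
      rw [smul_eq_mul, ← mul_assoc]
      exact hg _
  simpa [X_mul_divMonomial] using key _ hf 1

/-- Adjoining to a regular sequence distinct variables that occur neither in the ideal nor in the
sequence gives a regular sequence. -/
lemma isWeaklyRegular_append_map_X {Q : Ideal (MvPolynomial (Fin n) K)}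
    {rs : List (MvPolynomial (Fin n) K)} {L : List (Fin n)} (hL : L.Nodup)
    (hQ : ∀ j ∈ L, FreeOf j Q) (hrs : ∀ j ∈ L, ∀ r ∈ rs, j ∉ r.vars)
    (h : RingTheory.Sequence.IsWeaklyRegular (MvPolynomial (Fin n) K ⧸ Q) rs) :
    RingTheory.Sequence.IsWeaklyRegular (MvPolynomial (Fin n) K ⧸ Q) (rs ++ L.map X) := by
  rw [isWeaklyRegular_quotient_iff] at h ⊢
  intro i hi f hf
  rcases lt_or_ge i rs.length with hlt | hge
  · rw [List.getElem_append_left hlt] at hf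
    rw [List.take_append_of_le_length hlt.le] at hf ⊢
    exact h i hlt f hf
  · obtain ⟨m, rfl⟩ := Nat.exists_eq_add_of_le hge
    have hm : m < L.length := by simpa using hi
    have hfree : FreeOf L[m] (Q ⊔ Ideal.ofList ((rs ++ L.map X).take (rs.length + m))) := by
      refine (hQ _ (List.getElem_mem hm)).sup (freeOf_ofList ?_)
      rw [List.take_length_add_append]
      intro r hr
      rcases List.mem_append.1 hr with hr | hr
      · exact hrs _ (List.getElem_mem hm) r hr
      · rw [← List.map_take] at hr
        obtain ⟨i, hi, rfl⟩ := List.mem_map.1 hr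
        rw [vars_X, Finset.mem_singleton]
        rintro rfl
        obtain ⟨i, hi, heq⟩ := List.mem_take_iff_getElem.1 hi
        have := (List.Nodup.getElem_inj_iff hL).1 heq
        omega
    refine hfree.mem_of_X_mul_mem ?_
    simpa using hf

end FreeOf

/-! ### Polymatroidal ideals of degree two -/

section Structure

variable {K : Type*} [Field K] {n : ℕ} {I : Ideal (MvPolynomial (Fin n) K)}

/-- `i` and `j` are adjacent if `x_i x_j ∈ I`. A vertex may be adjacent to itself. -/
def Adj (I : Ideal (MvPolynomial (Fin n) K)) (i j : Fin n) : Prop :=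
  monomial (Finsupp.single i 1 + Finsupp.single j 1) (1 : K) ∈ I

open Classical in
/-- The neighbours of `c`. If `I` is polymatroidal of degree two and `c ∈ supp I` is not adjacent to
itself, then `supp I \ nbr I c` is the part of `c` in the complete multipartite graph `Adj I`. -/
def nbr (I : Ideal (MvPolynomial (Fin n) K)) (c : Fin n) : Finset (Fin n) :=
  Finset.univ.filter (Adj I c)

open Classical in
/-- The non-isolated vertices; for a polymatroidal ideal of degree two this is `supp I`. -/
def vertices (I : Ideal (MvPolynomial (Fin n) K)) : Finset (Fin n) :=
  Finset.univ.filter fun i => ∃ j, Adj I i j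

lemma mem_nbr {c j : Fin n} : j ∈ nbr I c ↔ Adj I c j := by simp [nbr]

lemma mem_vertices {i : Fin n} : i ∈ vertices I ↔ ∃ j, Adj I i j := by simp [vertices]

lemma Adj.symm {i j : Fin n} (h : Adj I i j) : Adj I j i := by
  rwa [Adj, add_comm]

lemma Adj.mem_left {i j : Fin n} (h : Adj I i j) : i ∈ vertices I := mem_vertices.2 ⟨j, h⟩

lemma Adj.mem_right {i j : Fin n} (h : Adj I i j) : j ∈ vertices I := h.symm.mem_left

lemma nbr_subset_vertices (c : Fin n) : nbr I c ⊆ vertices I := fun _ h =>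
  (mem_nbr.1 h).mem_right

lemma X_mul_X_mem {i j : Fin n} (h : Adj I i j) : (X i * X j : MvPolynomial (Fin n) K) ∈ I := by
  rwa [X, X, monomial_mul, one_mul]

lemma exists_minGens_le {a : Fin n →₀ ℕ} (ha : monomial a (1 : K) ∈ I) :
    ∃ b ∈ minGens I, b ≤ a := by
  obtain ⟨b, hb, hmin⟩ := exists_minimal_le_of_wellFoundedLT
    (fun b => monomial b (1 : K) ∈ I) a ha
  exact ⟨b, hmin, hb⟩

lemma exists_eq_single_add_single {u : Fin n →₀ ℕ} (hu : u.degree = 2) :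
    ∃ i j, u = Finsupp.single i 1 + Finsupp.single j 1 := by
  have key (d : ℕ) (w : Fin n →₀ ℕ) (hw : w.degree = d + 1) :
      ∃ i w', w = Finsupp.single i 1 + w' ∧ w'.degree = d := by
    obtain ⟨i, hi⟩ : ∃ i, w i ≠ 0 := by
      by_contra! h
      rw [show w = 0 from Finsupp.ext h, map_zero] at hw
      omega
    obtain ⟨w', rfl⟩ := exists_add_of_le
      (show Finsupp.single i 1 ≤ w by rw [Finsupp.single_le_iff]; omega)
    refine ⟨i, w', rfl, ?_⟩
    rw [map_add, Finsupp.degree_single] at hw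
    omega
  obtain ⟨i, w, rfl, hw⟩ := key 1 u hu
  obtain ⟨j, w', rfl, hw'⟩ := key 0 w hw
  rw [Finsupp.degree_eq_zero_iff] at hw'
  exact ⟨i, j, by rw [hw', add_zero]⟩

lemma sum_single_apply (A : Finset (Fin n)) (i : Fin n) (m : ℕ) :
    ∑ l ∈ A, (Finsupp.single i m : Fin n →₀ ℕ) l = if i ∈ A then m else 0 := by
  simp [Finsupp.single_apply]

lemma sum_single_add_apply (A : Finset (Fin n)) (i : Fin n) (b : Fin n →₀ ℕ) :
    ∑ l ∈ A, (Finsupp.single i 1 + b : Fin n →₀ ℕ) l = (if i ∈ A then 1 else 0) + ∑ l ∈ A, b l := by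
  simp only [Finsupp.add_apply, Finset.sum_add_distrib, sum_single_apply]

lemma exists_eq_single_add {b : Fin n →₀ ℕ} {i : Fin n} (h : b i ≠ 0) :
    ∃ b' : Fin n →₀ ℕ, b = Finsupp.single i 1 + b' :=
  exists_add_of_le (by rw [Finsupp.single_le_iff]; omega)

namespace IsPolymatroidal

lemma exists_adj_of_mem_minGens (hI : IsPolymatroidal I 2) {u : Fin n →₀ ℕ} (hu : u ∈ minGens I) :
    ∃ i j, Adj I i j ∧ u = Finsupp.single i 1 + Finsupp.single j 1 := by
  obtain ⟨i, j, rfl⟩ := exists_eq_single_add_single (hI.degree_eq u hu)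
  exact ⟨i, j, Minimal.prop (P := fun b => monomial b (1 : K) ∈ I) hu, rfl⟩

lemma single_add_single_mem_minGens (hI : IsPolymatroidal I 2) {i j : Fin n} (h : Adj I i j) :
    Finsupp.single i 1 + Finsupp.single j 1 ∈ minGens I := by
  obtain ⟨b, hb, hle⟩ := exists_minGens_le h
  obtain ⟨c, hc⟩ := exists_add_of_le hle
  have hdeg := congrArg Finsupp.degree hc
  rw [map_add, map_add, hI.degree_eq b hb, Finsupp.degree_single, Finsupp.degree_single] at hdeg
  have hc0 : c = 0 := by rw [← Finsupp.degree_eq_zero_iff]; omega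
  rw [hc, hc0, add_zero]
  exact hb

lemma supp_eq (hI : IsPolymatroidal I 2) : supp I = (vertices I : Set (Fin n)) := by
  ext i
  simp only [supp, Set.mem_ofPred_eq, Finset.mem_coe]
  constructor
  · rintro ⟨u, hu, hui⟩
    obtain ⟨a, b, hab, rfl⟩ := hI.exists_adj_of_mem_minGens hu
    by_cases ha : a = i
    · exact ha ▸ hab.mem_left
    · by_cases hb : b = i
      · exact hb ▸ hab.mem_right
      · simp [ha, hb] at hui
  · intro hi
    obtain ⟨j, hj⟩ := mem_vertices.1 hi
    exact ⟨_, hI.single_add_single_mem_minGens hj, by simp⟩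

lemma suppIdeal_eq (hI : IsPolymatroidal I 2) : suppIdeal I = varIdeal K (vertices I) := by
  rw [suppIdeal, varIdeal, hI.supp_eq]

lemma eq_span (hI : IsPolymatroidal I 2) :
    I = Ideal.span {g | ∃ i j, Adj I i j ∧ g = X i * X j} := by
  refine le_antisymm ?_ (Ideal.span_le.2 ?_)
  · obtain ⟨S, hS⟩ := hI.isMonomialIdeal
    conv_lhs => rw [hS]
    refine Ideal.span_le.2 ?_
    rintro _ ⟨a, ha, rfl⟩
    obtain ⟨b, hb, hle⟩ := exists_minGens_le (I := I) (a := a) (by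
      rw [hS]; exact Ideal.subset_span ⟨a, ha, rfl⟩)
    obtain ⟨i, j, hij, rfl⟩ := hI.exists_adj_of_mem_minGens hb
    refine Ideal.mem_of_dvd _ (monomial_one_dvd_monomial_one.2 hle)
      (Ideal.subset_span ⟨i, j, hij, ?_⟩)
    rw [X, X, monomial_mul, one_mul]
  · rintro _ ⟨i, j, hij, rfl⟩
    exact X_mul_X_mem hij

lemma freeOf (hI : IsPolymatroidal I 2) {j : Fin n} (hj : j ∉ vertices I) : FreeOf j I := by
  refine ⟨_, ?_, hI.eq_span⟩
  rintro _ ⟨a, b, hab, rfl⟩ h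
  rcases Finset.mem_union.1 (vars_mul _ _ h) with h | h <;>
    rw [vars_X, Finset.mem_singleton] at h <;> subst h
  exacts [hj hab.mem_left, hj hab.mem_right]

/-- Every vertex of `supp I` is adjacent to one of the two ends of any given edge. -/
lemma adj_or_adj (hI : IsPolymatroidal I 2) {i j k : Fin n} (h : Adj I i k) (hj : j ∈ vertices I) :
    Adj I j i ∨ Adj I j k := by
  obtain ⟨l, hl⟩ := mem_vertices.1 hj
  by_cases hji : j = i
  · subst hji; exact Or.inr h
  by_cases hjk : j = k
  · subst hjk; exact Or.inl h.symm
  by_cases hli : l = i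
  · subst hli; exact Or.inl hl
  by_cases hlk : l = k
  · subst hlk; exact Or.inr hl
  obtain ⟨m, hm, hmem⟩ := hI.exchange _ (hI.single_add_single_mem_minGens hl) _
    (hI.single_add_single_mem_minGens h) l (by simp [Ne.symm hli, Ne.symm hlk])
  rw [add_tsub_cancel_right] at hmem
  by_cases hmi : m = i
  · subst hmi; exact Or.inl hmem
  by_cases hmk : m = k
  · subst hmk; exact Or.inr hmem
  simp [Ne.symm hmi, Ne.symm hmk] at hm

/-! ### The powers of a polymatroidal ideal of degree two -/

/-- One edge can be split off a monomial satisfying the inequalities for `I ^ (k + 1)` so that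
the inequalities for `I ^ k` remain. If the inequality at `c` is an equality, the edge is
taken between the part of `c` and its complement, which lowers both sides by one. -/
lemma exists_adj_add (hI : IsPolymatroidal I 2) {k : ℕ} {a : Fin n →₀ ℕ}
    (h2 : 2 * (k + 1) ≤ ∑ i ∈ vertices I, a i)
    (h1 : ∀ c ∈ vertices I, k + 1 ≤ ∑ i ∈ nbr I c, a i) :
    ∃ i j b, Adj I i j ∧ a = Finsupp.single i 1 + (Finsupp.single j 1 + b) ∧
      2 * k ≤ ∑ i ∈ vertices I, b i ∧ ∀ c ∈ vertices I, k ≤ ∑ i ∈ nbr I c, b i := by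
  classical
  have hsum (i j : Fin n) (b : Fin n →₀ ℕ) (A : Finset (Fin n)) :
      ∑ l ∈ A, (Finsupp.single i 1 + (Finsupp.single j 1 + b) : Fin n →₀ ℕ) l =
        (if i ∈ A then 1 else 0) + ((if j ∈ A then 1 else 0) + ∑ l ∈ A, b l) := by
    rw [sum_single_add_apply, sum_single_add_apply]
  have hcompl (c : Fin n) := Finset.sum_sdiff (f := a) (nbr_subset_vertices (I := I) c)
  by_cases htight : ∃ c ∈ vertices I, ∑ i ∈ nbr I c, a i = k + 1
  · obtain ⟨c, hc, hck⟩ := htight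
    obtain ⟨i, hi, hai⟩ := Finset.exists_ne_zero_of_sum_ne_zero
      (show ∑ i ∈ vertices I \ nbr I c, a i ≠ 0 by have := hcompl c; omega)
    obtain ⟨j, hj, haj⟩ := Finset.exists_ne_zero_of_sum_ne_zero
      (show ∑ i ∈ nbr I c, a i ≠ 0 by omega)
    rw [Finset.mem_sdiff] at hi
    have hci : ¬ Adj I c i := fun h => hi.2 (mem_nbr.2 h)
    have hcj : Adj I c j := mem_nbr.1 hj
    have hij : Adj I i j := (hI.adj_or_adj hcj hi.1).resolve_left fun h => hci h.symm
    have hne : i ≠ j := by rintro rfl; exact hci hcj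
    -- If `d` is adjacent to both `i` and `j`, then the inequality at `d` is strict: otherwise
    -- the part of `d`, which lies in `nbr I c` and omits `j`, would already have weight `k + 1`.
    have hstrict (d : Fin n) (hd : d ∈ vertices I) (hdi : Adj I d i) (hdj : Adj I d j) :
        k + 2 ≤ ∑ l ∈ nbr I d, a l := by
      have hsub : insert j (vertices I \ nbr I d) ⊆ nbr I c := by
        refine Finset.insert_subset hj fun l hl => ?_
        rw [Finset.mem_sdiff, mem_nbr] at hl
        have hil : Adj I i l :=
          ((hI.adj_or_adj hdi hl.1).resolve_left fun h => hl.2 h.symm).symm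
        exact mem_nbr.2 ((hI.adj_or_adj hil hc).resolve_left hci)
      have hle := Finset.sum_le_sum_of_subset (f := a) hsub
      rw [Finset.sum_insert (by simp [mem_nbr, hdj])] at hle
      have := hcompl d
      have := h1 d hd
      omega
    obtain ⟨b₁, rfl⟩ := exists_eq_single_add hai
    obtain ⟨b, rfl⟩ := exists_eq_single_add (b := b₁) (i := j) (by simpa [hne] using haj)
    refine ⟨i, j, b, hij, rfl, ?_, fun d hd => ?_⟩
    · rw [hsum] at h2
      split_ifs at h2 <;> omega
    · have hd1 := h1 d hd
      by_cases hboth : i ∈ nbr I d ∧ j ∈ nbr I d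
      · have := hstrict d hd (mem_nbr.1 hboth.1) (mem_nbr.1 hboth.2)
        rw [hsum, if_pos hboth.1, if_pos hboth.2] at this
        omega
      · rw [hsum] at hd1
        by_cases hid : i ∈ nbr I d
        · have hjd : j ∉ nbr I d := fun h => hboth ⟨hid, h⟩
          simp only [hid, hjd, if_true, if_false] at hd1
          omega
        · simp only [hid, if_false] at hd1
          split_ifs at hd1 <;> omega
  · have h3 : ∀ c ∈ vertices I, k + 2 ≤ ∑ i ∈ nbr I c, a i := fun c hc => by
      have := h1 c hc
      have : ∑ i ∈ nbr I c, a i ≠ k + 1 := fun h => htight ⟨c, hc, h⟩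
      omega
    obtain ⟨i, hi, hai⟩ := Finset.exists_ne_zero_of_sum_ne_zero
      (show ∑ i ∈ vertices I, a i ≠ 0 by omega)
    obtain ⟨b₁, rfl⟩ := exists_eq_single_add hai
    obtain ⟨j, hj, hbj⟩ := Finset.exists_ne_zero_of_sum_ne_zero
      (show ∑ l ∈ nbr I i, b₁ l ≠ 0 by
        have := h3 i hi
        rw [sum_single_add_apply] at this
        split_ifs at this <;> omega)
    obtain ⟨b, rfl⟩ := exists_eq_single_add hbj
    refine ⟨i, j, b, mem_nbr.1 hj, rfl, ?_, fun d hd => ?_⟩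
    · rw [hsum] at h2
      split_ifs at h2 <;> omega
    · have := h3 d hd
      rw [hsum] at this
      split_ifs at this <;> omega

lemma monomial_mem_pow (hI : IsPolymatroidal I 2) {k : ℕ} {a : Fin n →₀ ℕ}
    (h2 : 2 * k ≤ ∑ i ∈ vertices I, a i) (h1 : ∀ c ∈ vertices I, k ≤ ∑ i ∈ nbr I c, a i) :
    monomial a (1 : K) ∈ I ^ k := by
  induction k generalizing a with
  | zero => simp
  | succ k ih =>
    obtain ⟨i, j, b, hij, rfl, hb2, hb1⟩ := hI.exists_adj_add h2 h1
    rw [← add_assoc, ← one_mul (1 : K), ← monomial_mul, pow_succ']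
    exact Ideal.mul_mem_mul hij (ih hb2 hb1)

/-- The powers of `I` are intersections of powers of monomial primes. -/
lemma pow_eq (hI : IsPolymatroidal I 2) (k : ℕ) :
    I ^ k = varIdeal K (vertices I) ^ (2 * k) ⊓
      (vertices I).inf fun c => varIdeal K (nbr I c) ^ k := by
  refine le_antisymm (le_inf ?_ (Finset.le_inf fun c hc => ?_)) fun f hf => ?_
  · rw [pow_mul]
    refine Ideal.pow_right_mono ?_ k
    rw [hI.eq_span, Ideal.span_le]
    rintro _ ⟨i, j, hij, rfl⟩
    rw [← hI.eq_span, sq]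
    exact Ideal.mul_mem_mul (X_mem_varIdeal hij.mem_left) (X_mem_varIdeal hij.mem_right)
  · refine Ideal.pow_right_mono ?_ k
    conv_lhs => rw [hI.eq_span]
    rw [Ideal.span_le]
    rintro _ ⟨i, j, hij, rfl⟩
    rcases hI.adj_or_adj hij hc with h | h
    · exact Ideal.mul_mem_right _ _ (X_mem_varIdeal (mem_nbr.2 h))
    · exact Ideal.mul_mem_left _ _ (X_mem_varIdeal (mem_nbr.2 h))
  · obtain ⟨hf2, hf1⟩ := hf
    have hf2 : f ∈ varIdeal K (vertices I) ^ (2 * k) := hf2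
    rw [mem_varIdeal_pow] at hf2
    rw [SetLike.mem_coe, Submodule.mem_finsetInf] at hf1
    rw [f.as_sum]
    refine Ideal.sum_mem _ fun a ha => ?_
    rw [← mul_one (coeff a f), ← C_mul_monomial]
    exact Ideal.mul_mem_left _ _ (hI.monomial_mem_pow (hf2 a ha) fun c hc =>
      (mem_varIdeal_pow _ _ _).1 (hf1 c hc) a ha)

lemma mem_pow_iff (hI : IsPolymatroidal I 2) (k : ℕ) (f : MvPolynomial (Fin n) K) :
    f ∈ I ^ k ↔ ∀ a ∈ f.support, 2 * k ≤ ∑ i ∈ vertices I, a i ∧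
      ∀ c ∈ vertices I, k ≤ ∑ i ∈ nbr I c, a i := by
  rw [hI.pow_eq, Submodule.mem_inf, Submodule.mem_finsetInf, mem_varIdeal_pow]
  simp only [mem_varIdeal_pow]
  exact ⟨fun h a ha => ⟨h.1 a ha, fun c hc => h.2 c hc a ha⟩,
    fun h => ⟨fun a ha => (h a ha).1, fun c hc a ha => (h a ha).2 c hc⟩⟩

lemma monomial_mem_pow_iff (hI : IsPolymatroidal I 2) (k : ℕ) (a : Fin n →₀ ℕ) :
    monomial a (1 : K) ∈ I ^ k ↔ 2 * k ≤ ∑ i ∈ vertices I, a i ∧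
      ∀ c ∈ vertices I, k ≤ ∑ i ∈ nbr I c, a i := by
  classical
  rw [hI.mem_pow_iff, support_monomial, if_neg one_ne_zero]
  simp

end IsPolymatroidal

end Structure

/-! ### Associated primes of the powers -/

section Powers

variable {K : Type*} [Field K] {n : ℕ} {I : Ideal (MvPolynomial (Fin n) K)}

/-- The monomial primes generated by the complements in `supp I` of the loopless parts. -/
def partPrimes (I : Ideal (MvPolynomial (Fin n) K)) : Set (Ideal (MvPolynomial (Fin n) K)) :=
  {P | ∃ c ∈ vertices I, ¬ Adj I c c ∧ P = varIdeal K (nbr I c)}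

/-- `x^u` represents a nonzero element of the socle of `K[x_i : i ∈ supp I] / I ^ k`. -/
structure IsSocleExponent (I : Ideal (MvPolynomial (Fin n) K)) (k : ℕ) (u : Fin n →₀ ℕ) : Prop where
  apply_eq_zero : ∀ i ∉ vertices I, u i = 0
  notMem : monomial u (1 : K) ∉ I ^ k
  X_mul_mem : ∀ i ∈ vertices I, X i * monomial u (1 : K) ∈ I ^ k

lemma varIdeal_vertices_notMem_partPrimes : varIdeal K (vertices I) ∉ partPrimes I := by
  rintro ⟨c, hc, hcc, h⟩
  exact hcc (mem_nbr.1 (varIdeal_injective h ▸ hc))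

lemma varIdeal_vertices_notMem_Ass_pow_zero : varIdeal K (vertices I) ∉ Ass (I ^ 0) := by
  rw [pow_zero, Ideal.one_eq_top, Ass_top]
  exact Set.notMem_empty _

lemma Ass_inf_varIdeal_nbr_pow_subset (k : ℕ) :
    Ass ((vertices I).inf fun c => varIdeal K (nbr I c) ^ k) ⊆
      {P | ∃ c ∈ vertices I, P = varIdeal K (nbr I c)} := by
  intro P hP
  obtain ⟨c, hc, hcP⟩ := Set.mem_iUnion₂.1 (Ass_finset_inf_subset _ _ hP)
  exact ⟨c, hc, Ass_varIdeal_pow_subset _ _ hcP⟩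

/-- The variables outside `supp I`, as a sequence. -/
def freeVars (I : Ideal (MvPolynomial (Fin n) K)) :
    List (MvPolynomial (Fin n) K) :=
  (vertices I)ᶜ.toList.map X

lemma mem_freeVars {r : MvPolynomial (Fin n) K} :
    r ∈ freeVars I ↔ ∃ i ∉ vertices I, r = X i := by
  simp [freeVars, eq_comm]

lemma length_freeVars : (freeVars I).length = (vertices I)ᶜ.card := by
  simp [freeVars]

lemma ofList_freeVars_le :
    Ideal.ofList (freeVars I) ≤ varIdeal K (vertices I)ᶜ := by
  refine Ideal.span_le.2 fun r hr => ?_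
  obtain ⟨i, hi, rfl⟩ := mem_freeVars.1 hr
  exact X_mem_varIdeal (Finset.mem_compl.2 hi)

namespace IsPolymatroidal

lemma nbr_eq_of_not_adj (hI : IsPolymatroidal I 2) {c d : Fin n} (hc : c ∈ vertices I)
    (hd : d ∈ vertices I) (h : ¬ Adj I c d) : nbr I c = nbr I d := by
  ext j
  rw [mem_nbr, mem_nbr]
  exact ⟨fun hj => ((hI.adj_or_adj hj hd).resolve_left fun h' => h h'.symm),
    fun hj => (hI.adj_or_adj hj hc).resolve_left h⟩

lemma nbr_eq_vertices (hI : IsPolymatroidal I 2) {c : Fin n} (h : Adj I c c) :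
    nbr I c = vertices I := by
  refine (nbr_subset_vertices c).antisymm fun j hj => mem_nbr.2 ?_
  exact ((hI.adj_or_adj h hj).elim id id).symm

lemma Ass_pow_subset (hI : IsPolymatroidal I 2) (k : ℕ) :
    Ass (I ^ k) ⊆ insert (varIdeal K (vertices I)) (partPrimes I) := by
  rw [hI.pow_eq k]
  intro P hP
  rcases Ass_inf_subset _ _ hP with hP | hP
  · exact Or.inl (Ass_varIdeal_pow_subset _ _ hP)
  · obtain ⟨c, hc, rfl⟩ := Ass_inf_varIdeal_nbr_pow_subset k hP
    by_cases hcc : Adj I c c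
    · exact Or.inl (by rw [hI.nbr_eq_vertices hcc])
    · exact Or.inr ⟨c, hc, hcc, rfl⟩

/-- The prime belonging to the part of `c` is the annihilator of `x_c^{2k} x_b^{k-1}`, where `b` is
adjacent to `c`. -/
lemma partPrimes_subset_Ass_pow (hI : IsPolymatroidal I 2) {k : ℕ} (hk : 1 ≤ k) :
    partPrimes I ⊆ Ass (I ^ k) := by
  classical
  rintro _ ⟨c, hc, hcc, rfl⟩
  obtain ⟨b, hb⟩ := mem_vertices.1 hc
  have hbN : b ∈ nbr I c := mem_nbr.2 hb
  have hcN : c ∉ nbr I c := fun h => hcc (mem_nbr.1 h)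
  set u : Fin n →₀ ℕ := Finsupp.single c (2 * k) + Finsupp.single b (k - 1) with hu
  have hsum (A : Finset (Fin n)) (a : Fin n →₀ ℕ) : ∑ i ∈ A, (a + u) i =
      ∑ i ∈ A, a i + ((if c ∈ A then 2 * k else 0) + (if b ∈ A then k - 1 else 0)) := by
    simp only [hu, Finsupp.add_apply, Finset.sum_add_distrib, sum_single_apply]
  refine mem_Ass_iff.2 ⟨inferInstance, monomial u 1, fun g => ⟨fun hg => ?_, fun hg => ?_⟩⟩
  · rw [mem_varIdeal] at hg
    rw [hI.mem_pow_iff]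
    intro a' ha'
    obtain ⟨a, ha, v, hv, rfl⟩ := Finset.mem_add.1 (support_mul _ _ ha')
    obtain rfl : v = u := by simpa using support_monomial_subset hv
    refine ⟨?_, fun d hd => ?_⟩
    · rw [hsum, if_pos hc]
      omega
    · by_cases hcd : c ∈ nbr I d
      · rw [hsum, if_pos hcd]
        omega
      · rw [← hI.nbr_eq_of_not_adj hc hd fun h => hcd (mem_nbr.2 h.symm), hsum, if_pos hbN]
        have := hg a ha
        omega
  · rw [mem_varIdeal]
    intro a ha
    rw [hI.mem_pow_iff] at hg
    have := (hg (a + u) (by rw [mem_support_iff, coeff_mul_monomial, mul_one]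
                            exact mem_support_iff.1 ha)).2 c hc
    rw [hsum, if_neg hcN, if_pos hbN] at this
    omega

lemma varIdeal_vertices_mem_Ass_pow (hI : IsPolymatroidal I 2) {k : ℕ} {u : Fin n →₀ ℕ}
    (hu : IsSocleExponent I k u) : varIdeal K (vertices I) ∈ Ass (I ^ k) := by
  refine mem_Ass_iff.2 ⟨inferInstance, monomial u 1, fun g => ⟨fun hg => ?_, fun hg => ?_⟩⟩
  · have hle : varIdeal K (vertices I) ≤ (I ^ k).colon {monomial u 1} := by
      refine Ideal.span_le.2 ?_
      rintro _ ⟨i, hi, rfl⟩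
      exact Submodule.mem_colon_singleton.2 (hu.X_mul_mem i hi)
    exact Submodule.mem_colon_singleton.1 (hle hg)
  · rw [mem_varIdeal]
    intro a ha
    by_contra hlt
    have h0 : ∀ i ∈ vertices I, a i = 0 := by
      rw [← Finset.sum_eq_zero_iff]
      omega
    have hsum (A : Finset (Fin n)) (hA : A ⊆ vertices I) :
        ∑ i ∈ A, (a + u) i = ∑ i ∈ A, u i :=
      Finset.sum_congr rfl fun i hi => by simp [h0 i (hA hi)]
    rw [hI.mem_pow_iff] at hg
    have := hg (a + u) (by rw [mem_support_iff, coeff_mul_monomial, mul_one]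
                           exact mem_support_iff.1 ha)
    rw [hsum _ (Finset.Subset.refl _)] at this
    refine hu.notMem ((hI.monomial_mem_pow_iff k u).2 ⟨this.1, fun c hc => ?_⟩)
    rw [← hsum _ (nbr_subset_vertices c)]
    exact this.2 c hc

lemma Ass_pow_of_isSocleExponent (hI : IsPolymatroidal I 2) {k : ℕ} (hk : 1 ≤ k)
    {u : Fin n →₀ ℕ} (hu : IsSocleExponent I k u) :
    Ass (I ^ k) = insert (varIdeal K (vertices I)) (partPrimes I) :=
  (hI.Ass_pow_subset k).antisymm
    (Set.insert_subset (hI.varIdeal_vertices_mem_Ass_pow hu) (hI.partPrimes_subset_Ass_pow hk))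

lemma Ass_pow_of_eq_inf (hI : IsPolymatroidal I 2) {k : ℕ} (hk : 1 ≤ k)
    (hloop : ∀ c, ¬ Adj I c c)
    (h : I ^ k = (vertices I).inf fun c => varIdeal K (nbr I c) ^ k) :
    Ass (I ^ k) = partPrimes I := by
  refine Set.Subset.antisymm ?_ (hI.partPrimes_subset_Ass_pow hk)
  rw [h]
  intro P hP
  obtain ⟨c, hc, hP⟩ := Ass_inf_varIdeal_nbr_pow_subset k hP
  exact ⟨c, hc, hloop c, hP⟩

/-! ### Socle elements and redundancy of the powers of the support ideal -/

lemma isSocleExponent_zero (hI : IsPolymatroidal I 2) (h : vertices I = ∅) {k : ℕ} (hk : 1 ≤ k) :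
    IsSocleExponent I k 0 where
  apply_eq_zero _ _ := rfl
  notMem hmem := by
    have := ((hI.monomial_mem_pow_iff k 0).1 hmem).1
    simp only [h, Finset.sum_empty] at this
    omega
  X_mul_mem i hi := by simp [h] at hi

lemma isSocleExponent_of_loop (hI : IsPolymatroidal I 2) {b : Fin n} (hb : Adj I b b) {k : ℕ}
    (hk : 1 ≤ k) : IsSocleExponent I k (Finsupp.single b (2 * k - 1)) where
  apply_eq_zero i hi := Finsupp.single_eq_of_ne (by rintro rfl; exact hi hb.mem_left)
  notMem hmem := by
    have := ((hI.monomial_mem_pow_iff k _).1 hmem).1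
    simp only [Finsupp.single_apply, Finset.sum_ite_eq, hb.mem_left, if_true] at this
    omega
  X_mul_mem i hi := by
    rw [X, monomial_mul, one_mul, hI.monomial_mem_pow_iff]
    simp only [sum_single_add_apply, Finsupp.single_apply, Finset.sum_ite_eq, hb.mem_left,
      if_true, hi]
    refine ⟨by omega, fun c hc => ?_⟩
    rw [if_pos (mem_nbr.2 ((hI.adj_or_adj hb hc).elim id id))]
    omega

lemma isSocleExponent_of_triangle (hI : IsPolymatroidal I 2) {a b c : Fin n} (hab : Adj I a b)
    (hbc : Adj I b c) (hac : Adj I a c) {k : ℕ} (hk : 2 ≤ k) :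
    IsSocleExponent I k
      (Finsupp.single c 1 + (Finsupp.single a (k - 1) + Finsupp.single b (k - 1))) := by
  have hsum (A : Finset (Fin n)) :
      ∑ i ∈ A, (Finsupp.single a (k - 1) + Finsupp.single b (k - 1) : Fin n →₀ ℕ) i =
        (if a ∈ A then k - 1 else 0) + (if b ∈ A then k - 1 else 0) := by
    simp only [Finsupp.add_apply, Finset.sum_add_distrib, sum_single_apply]
  refine ⟨fun i hi => ?_, fun hmem => ?_, fun i hi => ?_⟩
  · have ha : i ≠ a := by rintro rfl; exact hi hab.mem_left
    have hb : i ≠ b := by rintro rfl; exact hi hbc.mem_left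
    have hc : i ≠ c := by rintro rfl; exact hi hbc.mem_right
    simp [ha, hb, hc]
  · have := ((hI.monomial_mem_pow_iff k _).1 hmem).1
    rw [sum_single_add_apply, hsum, if_pos hab.mem_left, if_pos hbc.mem_left,
      if_pos hbc.mem_right] at this
    omega
  · rw [X, monomial_mul, one_mul, hI.monomial_mem_pow_iff]
    refine ⟨?_, fun d hd => ?_⟩
    · rw [sum_single_add_apply, sum_single_add_apply, hsum, if_pos hab.mem_left,
        if_pos hbc.mem_left, if_pos hbc.mem_right, if_pos hi]
      omega
    · -- `d` is adjacent to at least two of the three vertices of the triangle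
      have h1 := hI.adj_or_adj hab hd
      have h2 := hI.adj_or_adj hbc hd
      have h3 := hI.adj_or_adj hac hd
      rw [← mem_nbr, ← mem_nbr] at h1 h2 h3
      rw [sum_single_add_apply, sum_single_add_apply, hsum]
      split_ifs <;> first | omega | tauto

/-- Without loops, the `2k`-th power of the support ideal is redundant for `k = 1`. -/
lemma eq_inf_of_loopless (hI : IsPolymatroidal I 2) (hloop : ∀ c, ¬ Adj I c c)
    (hne : (vertices I).Nonempty) :
    I ^ 1 = (vertices I).inf fun c => varIdeal K (nbr I c) ^ 1 := by
  rw [hI.pow_eq 1, inf_eq_right]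
  intro f hf
  rw [Submodule.mem_finsetInf] at hf
  rw [mem_varIdeal_pow]
  intro a ha
  have hN (c : Fin n) (hc : c ∈ vertices I) : ∃ j, Adj I c j ∧ a j ≠ 0 := by
    have := (mem_varIdeal_pow _ _ _).1 (hf c hc) a ha
    obtain ⟨j, hj, haj⟩ := Finset.exists_ne_zero_of_sum_ne_zero
      (show ∑ i ∈ nbr I c, a i ≠ 0 by omega)
    exact ⟨j, mem_nbr.1 hj, haj⟩
  obtain ⟨c, hc⟩ := hne
  obtain ⟨i, hci, hi⟩ := hN c hc
  obtain ⟨j, hij, hj⟩ := hN i hci.mem_right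
  have hne : i ≠ j := by rintro rfl; exact hloop i hij
  have hsub : ({i, j} : Finset (Fin n)) ⊆ vertices I := by
    simp [Finset.insert_subset_iff, hij.mem_left, hij.mem_right]
  have := Finset.sum_le_sum_of_subset (f := a) hsub
  rw [Finset.sum_pair hne] at this
  omega

/-- Without triangles, the `2k`-th power of the support ideal is redundant for all `k`. -/
lemma eq_inf_of_triangleFree (hI : IsPolymatroidal I 2)
    (htri : ∀ a b c, Adj I a b → Adj I b c → ¬ Adj I a c) (hne : (vertices I).Nonempty) (k : ℕ) :
    I ^ k = (vertices I).inf fun c => varIdeal K (nbr I c) ^ k := by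
  rw [hI.pow_eq k, inf_eq_right]
  intro f hf
  rw [Submodule.mem_finsetInf] at hf
  rw [mem_varIdeal_pow]
  intro m hm
  obtain ⟨a, ha⟩ := hne
  obtain ⟨b, hab⟩ := mem_vertices.1 ha
  have hdisj : Disjoint (nbr I a) (nbr I b) := Finset.disjoint_left.2 fun i hia hib =>
    htri a b i hab (mem_nbr.1 hib) (mem_nbr.1 hia)
  have h1 := (mem_varIdeal_pow _ _ _).1 (hf a ha) m hm
  have h2 := (mem_varIdeal_pow _ _ _).1 (hf b hab.mem_right) m hm
  have h3 := Finset.sum_le_sum_of_subset (f := m)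
    (Finset.union_subset (nbr_subset_vertices (I := I) a) (nbr_subset_vertices b))
  rw [Finset.sum_union hdisj] at h3
  omega

/-! ### Depth of the powers -/

lemma pow_le_maxIdeal (hI : IsPolymatroidal I 2) {k : ℕ} (hk : 1 ≤ k) :
    I ^ k ≤ maxIdeal K n := by
  refine (Ideal.pow_le_self (by omega)).trans ?_
  rw [hI.eq_span, Ideal.span_le]
  rintro _ ⟨i, j, -, rfl⟩
  exact Ideal.mul_mem_right _ _ (X_mem_maxIdeal i)

lemma isWeaklyRegular_append_freeVars (hI : IsPolymatroidal I 2) {k : ℕ}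
    {rs : List (MvPolynomial (Fin n) K)} (hrs : ∀ r ∈ rs, r.vars ⊆ vertices I)
    (h : RingTheory.Sequence.IsWeaklyRegular (MvPolynomial (Fin n) K ⧸ I ^ k) rs) :
    RingTheory.Sequence.IsWeaklyRegular (MvPolynomial (Fin n) K ⧸ I ^ k) (rs ++ freeVars I) := by
  refine isWeaklyRegular_append_map_X (Finset.nodup_toList _) (fun j hj => ?_)
    (fun j hj r hr hjr => ?_) h
  · exact (hI.freeOf (by simpa using hj)).pow k
  · exact (by simpa using hj : j ∉ vertices I) (hrs r hr hjr)

lemma depthQuot_pow_of_isSocleExponent (hI : IsPolymatroidal I 2) {k : ℕ} (hk : 1 ≤ k)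
    {u : Fin n →₀ ℕ} (hu : IsSocleExponent I k u) :
    depthQuot (I ^ k) = ((vertices I)ᶜ.card : ℕ∞) := by
  classical
  have hreg := hI.isWeaklyRegular_append_freeVars (k := k) (rs := []) (by simp) (by simp)
  rw [List.nil_append] at hreg
  rw [← length_freeVars]
  refine depth_quotient_eq_length (hI.pow_le_maxIdeal hk) maxIdeal_ne_top ?_ hreg
    (f := monomial u 1) ?_ (maxIdeal_mul_mem fun i => ?_)
  · intro r hr
    obtain ⟨i, -, rfl⟩ := mem_freeVars.1 hr
    exact X_mem_maxIdeal i
  · intro hmem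
    obtain ⟨g, hg, h, hh, hgh⟩ := Submodule.mem_sup.1 hmem
    have hcoeff : coeff u g + coeff u h = 1 := by
      rw [← coeff_add, hgh, coeff_monomial, if_pos rfl]
    by_cases hug : coeff u g = 0
    · have := (mem_varIdeal _ _).1 (ofList_freeVars_le hh) u (mem_support_iff.2 fun h0 => by
        rw [hug, h0, add_zero] at hcoeff
        exact zero_ne_one hcoeff)
      rw [Finset.sum_eq_zero fun i hi => hu.apply_eq_zero i (Finset.mem_compl.1 hi)] at this
      omega
    · exact hu.notMem ((hI.monomial_mem_pow_iff k u).2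
        ((hI.mem_pow_iff k g).1 hg u (mem_support_iff.2 hug)))
  · by_cases hi : i ∈ vertices I
    · exact Ideal.mem_sup_left (hu.X_mul_mem i hi)
    · exact Ideal.mem_sup_right (Ideal.mul_mem_right _ _
        (Ideal.subset_span (mem_freeVars.2 ⟨i, hi, rfl⟩)))

lemma isWeaklyRegular_cons_freeVars (hI : IsPolymatroidal I 2) {k : ℕ}
    (h : I ^ k = (vertices I).inf fun c => varIdeal K (nbr I c) ^ k)
    {y : MvPolynomial (Fin n) K} (hy : y.vars ⊆ vertices I)
    (hyN : ∀ c ∈ vertices I, y ∉ varIdeal K (nbr I c)) :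
    RingTheory.Sequence.IsWeaklyRegular (MvPolynomial (Fin n) K ⧸ I ^ k) (y :: freeVars I) := by
  refine hI.isWeaklyRegular_append_freeVars (rs := [y]) (by simpa using hy) ?_
  rw [isWeaklyRegular_quotient_iff]
  intro i hi f hf
  obtain rfl : i = 0 := by simpa using hi
  simp only [List.getElem_cons_zero, List.take_zero, Ideal.ofList_nil, sup_bot_eq] at hf ⊢
  refine mem_of_mul_mem_of_notMem_Ass (fun P hP => ?_) hf
  rw [h] at hP
  obtain ⟨c, hc, rfl⟩ := Ass_inf_varIdeal_nbr_pow_subset k hP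
  exact hyN c hc

/-- Without loops, the sum of the variables in `supp I` is a nonzerodivisor modulo `I`. -/
lemma lt_depthQuot_of_loopless (hI : IsPolymatroidal I 2) (hloop : ∀ c, ¬ Adj I c c)
    (hne : (vertices I).Nonempty) :
    ((vertices I)ᶜ.card : ℕ∞) < depthQuot (I ^ 1) := by
  classical
  have hreg := hI.isWeaklyRegular_cons_freeVars (hI.eq_inf_of_loopless hloop hne)
    (y := ∑ i ∈ vertices I, X i) ?_ fun c hc hmem => ?_
  · have := length_le_depth (hI.pow_le_maxIdeal le_rfl) maxIdeal_ne_top ?_ hreg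
    · refine lt_of_lt_of_le ?_ this
      rw [List.length_cons, length_freeVars]
      exact Nat.cast_lt.2 (Nat.lt_succ_self _)
    · intro r hr
      rcases List.mem_cons.1 hr with rfl | hr
      · exact Ideal.sum_mem _ fun i _ => X_mem_maxIdeal i
      · obtain ⟨i, -, rfl⟩ := mem_freeVars.1 hr
        exact X_mem_maxIdeal i
  · refine (vars_sum_subset _ _).trans (Finset.biUnion_subset.2 fun i hi => ?_)
    simpa [vars_X] using hi
  · have := (mem_varIdeal _ _).1 hmem (Finsupp.single c 1) (by
      rw [mem_support_iff, coeff_sum]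
      simp [coeff_X, Finsupp.single_left_inj, hc])
    rw [Finset.sum_eq_zero fun i hi => Finsupp.single_eq_of_ne (by
      rintro rfl; exact hloop _ (mem_nbr.1 hi))] at this
    omega

/-- In the bipartite case `y = x_a + x_b`, for an edge `ab`, is a nonzerodivisor modulo `I ^ k`, and
`(x_a x_b)^{k-1} x_a` represents a socle element after dividing out `y`. -/
lemma depthQuot_pow_of_triangleFree (hI : IsPolymatroidal I 2)
    (htri : ∀ a b c, Adj I a b → Adj I b c → ¬ Adj I a c) (hne : (vertices I).Nonempty) {k : ℕ}
    (hk : 1 ≤ k) : depthQuot (I ^ k) = (((vertices I)ᶜ.card + 1 : ℕ) : ℕ∞) := by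
  classical
  obtain ⟨m, rfl⟩ := Nat.exists_eq_add_of_le' hk
  have hinf := hI.eq_inf_of_triangleFree htri hne (m + 1)
  obtain ⟨a, ha⟩ := hne
  obtain ⟨b, hab⟩ := mem_vertices.1 ha
  have hb := hab.mem_right
  have hne : b ≠ a := by rintro rfl; exact htri b b b hab hab hab
  have hreg := hI.isWeaklyRegular_cons_freeVars hinf (y := X a + X b)
    ((vars_add_subset _ _).trans (by
      rw [vars_X, vars_X, Finset.union_subset_iff]
      simp [ha, hb]))
    fun c hc hmem => by
      rcases hI.adj_or_adj hab hc with h | h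
      · rw [Ideal.add_mem_iff_right _ (X_mem_varIdeal (mem_nbr.2 h)), X_mem_varIdeal_iff,
          mem_nbr] at hmem
        exact htri c a b h hab hmem
      · rw [Ideal.add_mem_iff_left _ (X_mem_varIdeal (mem_nbr.2 h)), X_mem_varIdeal_iff,
          mem_nbr] at hmem
        exact htri c b a h hab.symm hmem
  have hedge {i j : Fin n} (h : Adj I i j) :
      (X a * X b) ^ m * (X i * X j) ∈ I ^ (m + 1) := by
    rw [pow_succ]
    exact Ideal.mul_mem_mul (Ideal.pow_mem_pow (X_mul_X_mem hab) m) (X_mul_X_mem h)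
  have hlen : ((X a + X b) :: freeVars I).length = (vertices I)ᶜ.card + 1 := by
    rw [List.length_cons, length_freeVars]
  rw [← hlen]
  refine depth_quotient_eq_length (hI.pow_le_maxIdeal hk) maxIdeal_ne_top ?_ hreg
    (f := (X a * X b) ^ m * X a) ?_ (maxIdeal_mul_mem fun i => ?_)
  · intro r hr
    rcases List.mem_cons.1 hr with rfl | hr
    · exact add_mem (X_mem_maxIdeal a) (X_mem_maxIdeal b)
    · obtain ⟨i, -, rfl⟩ := mem_freeVars.1 hr
      exact X_mem_maxIdeal i
  · -- Evaluate at `x_a = t`, `x_b = -t` and zero elsewhere: the ideal goes into `(t^{2m+2})`,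
    -- whereas the element goes to `± t^{2m+1}`.
    intro hmem
    set θ : MvPolynomial (Fin n) K →ₐ[K] Polynomial K :=
      aeval fun i => if i = a then Polynomial.X else if i = b then -Polynomial.X else 0 with hθ
    have hθa : θ (X a) = Polynomial.X := by simp [hθ]
    have hθb : θ (X b) = -Polynomial.X := by simp [hθ, hne]
    have hθX (i : Fin n) : Polynomial.X ∣ θ (X i) := by
      rw [hθ, aeval_X]
      split_ifs <;> simp
    have hIθ : I ≤ Ideal.comap θ (Ideal.span {Polynomial.X ^ 2}) := by
      conv_lhs => rw [hI.eq_span]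
      rw [Ideal.span_le]
      rintro _ ⟨i, j, -, rfl⟩
      rw [SetLike.mem_coe, Ideal.mem_comap, Ideal.mem_span_singleton, map_mul, sq]
      exact mul_dvd_mul (hθX i) (hθX j)
    have hle : I ^ (m + 1) ⊔ Ideal.ofList ((X a + X b) :: freeVars I) ≤
        Ideal.comap θ (Ideal.span {Polynomial.X ^ (2 * (m + 1))}) := by
      refine sup_le ?_ (Ideal.span_le.2 fun r hr => ?_)
      · rw [pow_mul, ← Ideal.span_singleton_pow]
        exact (Ideal.pow_right_mono hIθ _).trans (Ideal.le_comap_pow _ _)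
      · suffices θ r = 0 by rw [SetLike.mem_coe, Ideal.mem_comap, this]; exact zero_mem _
        rcases List.mem_cons.1 hr with rfl | hr
        · rw [map_add, hθa, hθb, add_neg_cancel]
        · obtain ⟨i, hi, rfl⟩ := mem_freeVars.1 hr
          have hia : i ≠ a := by rintro rfl; exact hi ha
          have hib : i ≠ b := by rintro rfl; exact hi hb
          simp [hθ, hia, hib]
    have hdvd := Ideal.mem_span_singleton.1 (Ideal.mem_comap.1 (hle hmem))
    have hval : θ ((X a * X b) ^ m * X a) = (-1) ^ m * Polynomial.X ^ (2 * m + 1) := by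
      rw [map_mul, map_pow, map_mul, hθa, hθb, mul_neg, neg_pow, ← sq, ← pow_mul, mul_assoc,
        ← pow_succ]
    rw [hval, (isUnit_one.neg.pow m).dvd_mul_left,
      pow_dvd_pow_iff Polynomial.X_ne_zero Polynomial.not_isUnit_X] at hdvd
    omega
  · by_cases hi : i ∈ vertices I
    · rcases hI.adj_or_adj hab hi with h | h
      · refine Ideal.mem_sup_left ?_
        rw [mul_left_comm]
        exact hedge h
      · have heq : X i * ((X a * X b) ^ m * X a) =
            X i * (X a * X b) ^ m * (X a + X b) -
              (X a * X b : MvPolynomial (Fin n) K) ^ m * (X i * X b) := by ring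
        rw [heq]
        exact sub_mem (Ideal.mem_sup_right (Ideal.mul_mem_left _ _ (Ideal.subset_span (by simp))))
          (Ideal.mem_sup_left (hedge h))
    · exact Ideal.mem_sup_right (Ideal.mul_mem_right _ _
        (Ideal.subset_span (List.mem_cons_of_mem _ (mem_freeVars.2 ⟨i, hi, rfl⟩))))

end IsPolymatroidal

/-! ### Stability indices -/

lemma sInf_stable_eq_one {α : Type*} {F : ℕ → α} (h : ∀ k, 1 ≤ k → F k = F 1) :
    (1 ∈ {k₀ | 1 ≤ k₀ ∧ ∀ k, k₀ ≤ k → F k = F k₀}) ∧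
      sInf {k₀ | 1 ≤ k₀ ∧ ∀ k, k₀ ≤ k → F k = F k₀} = 1 := by
  have hmem : 1 ∈ {k₀ | 1 ≤ k₀ ∧ ∀ k, k₀ ≤ k → F k = F k₀} := ⟨le_rfl, h⟩
  exact ⟨hmem, le_antisymm (Nat.sInf_le hmem) (Nat.sInf_mem ⟨_, hmem⟩).1⟩

lemma sInf_stable_eq_two {α : Type*} {F : ℕ → α} (h : ∀ k, 2 ≤ k → F k = F 2) (h1 : F 1 ≠ F 2) :
    (2 ∈ {k₀ | 1 ≤ k₀ ∧ ∀ k, k₀ ≤ k → F k = F k₀}) ∧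
      sInf {k₀ | 1 ≤ k₀ ∧ ∀ k, k₀ ≤ k → F k = F k₀} = 2 := by
  have hmem : 2 ∈ {k₀ | 1 ≤ k₀ ∧ ∀ k, k₀ ≤ k → F k = F k₀} := ⟨one_le_two, h⟩
  refine ⟨hmem, le_antisymm (Nat.sInf_le hmem) ?_⟩
  obtain ⟨hge, hstab⟩ := Nat.sInf_mem ⟨_, hmem⟩
  by_contra! hlt
  have heq : sInf {k₀ | 1 ≤ k₀ ∧ ∀ k, k₀ ≤ k → F k = F k₀} = 1 := by omega
  rw [heq] at hstab
  exact h1 (hstab 2 one_le_two).symm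

end Powers

end Polymatroidal

end

theorem mainTheorem1 {K : Type*} [Field K] {n : ℕ} (I : Ideal (MvPolynomial (Fin n) K))
    (hI : Polymatroidal.IsPolymatroidal I 2) :
    (Polymatroidal.assStable I).Nonempty ∧ (Polymatroidal.depthStable I).Nonempty ∧
    Polymatroidal.astab I = Polymatroidal.dstab I ∧
    (Polymatroidal.suppIdeal I ∉ Polymatroidal.assInfty I →
      Polymatroidal.astab I = 1 ∧ Polymatroidal.dstab I = 1) ∧
    (Polymatroidal.suppIdeal I ∈ Polymatroidal.assInfty I →
      ∃ t : ℕ, IsGreatest {k : ℕ | Polymatroidal.suppIdeal I ∉ Polymatroidal.Ass (I ^ k)} t ∧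
        Polymatroidal.astab I = t + 1 ∧ Polymatroidal.dstab I = t + 1) := by
  open Polymatroidal in
  have hzero := varIdeal_vertices_notMem_Ass_pow_zero (I := I)
  rw [hI.suppIdeal_eq]
  by_cases hsocle : ∀ k, 1 ≤ k → ∃ u, IsSocleExponent I k u
  · -- The power of the support ideal is never redundant.
    have hAss (k : ℕ) (hk : 1 ≤ k) := hI.Ass_pow_of_isSocleExponent hk (hsocle k hk).choose_spec
    have hdepth (k : ℕ) (hk : 1 ≤ k) :=
      hI.depthQuot_pow_of_isSocleExponent hk (hsocle k hk).choose_spec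
    obtain ⟨ha, ha1⟩ := sInf_stable_eq_one (F := fun k => Ass (I ^ k)) fun k hk =>
      (hAss k hk).trans (hAss 1 le_rfl).symm
    obtain ⟨hd, hd1⟩ := sInf_stable_eq_one (F := fun k => depthQuot (I ^ k)) fun k hk =>
      (hdepth k hk).trans (hdepth 1 le_rfl).symm
    have ha1 : astab I = 1 := ha1
    have hd1 : dstab I = 1 := hd1
    refine ⟨⟨1, ha⟩, ⟨1, hd⟩, ha1.trans hd1.symm, fun _ => ⟨ha1, hd1⟩, fun _ =>
      ⟨0, ⟨hzero, fun k hk => ?_⟩, ha1, hd1⟩⟩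
    by_contra! hpos
    exact hk (by rw [hAss k hpos]; exact Set.mem_insert _ _)
  · have hloop : ∀ c, ¬ Adj I c c := fun c hc =>
      hsocle fun k hk => ⟨_, hI.isSocleExponent_of_loop hc hk⟩
    have hne : (vertices I).Nonempty := by
      by_contra h
      rw [Finset.not_nonempty_iff_eq_empty] at h
      exact hsocle fun k hk => ⟨_, hI.isSocleExponent_zero h hk⟩
    by_cases htri : ∀ a b c, Adj I a b → Adj I b c → ¬ Adj I a c
    · -- The power of the support ideal is always redundant.
      have hAss (k : ℕ) (hk : 1 ≤ k) :=
        hI.Ass_pow_of_eq_inf hk hloop (hI.eq_inf_of_triangleFree htri hne k)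
      have hdepth (k : ℕ) (hk : 1 ≤ k) := hI.depthQuot_pow_of_triangleFree htri hne hk
      obtain ⟨ha, ha1⟩ := sInf_stable_eq_one (F := fun k => Ass (I ^ k)) fun k hk =>
        (hAss k hk).trans (hAss 1 le_rfl).symm
      obtain ⟨hd, hd1⟩ := sInf_stable_eq_one (F := fun k => depthQuot (I ^ k)) fun k hk =>
        (hdepth k hk).trans (hdepth 1 le_rfl).symm
      have ha1 : astab I = 1 := ha1
      have hd1 : dstab I = 1 := hd1
      refine ⟨⟨1, ha⟩, ⟨1, hd⟩, ha1.trans hd1.symm, fun _ => ⟨ha1, hd1⟩, fun hmem => ?_⟩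
      rw [assInfty, ha1, hAss 1 le_rfl] at hmem
      exact absurd hmem varIdeal_vertices_notMem_partPrimes
    · -- The power of the support ideal is redundant exactly for the first power of `I`.
      push Not at htri
      obtain ⟨a, b, c, hab, hbc, hac⟩ := htri
      have hAss (k : ℕ) (hk : 2 ≤ k) := hI.Ass_pow_of_isSocleExponent (one_le_two.trans hk)
        (hI.isSocleExponent_of_triangle hab hbc hac hk)
      have hdepth (k : ℕ) (hk : 2 ≤ k) := hI.depthQuot_pow_of_isSocleExponent
        (one_le_two.trans hk) (hI.isSocleExponent_of_triangle hab hbc hac hk)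
      have hAss1 : varIdeal K (vertices I) ∉ Ass (I ^ 1) := by
        rw [hI.Ass_pow_of_eq_inf le_rfl hloop (hI.eq_inf_of_loopless hloop hne)]
        exact varIdeal_vertices_notMem_partPrimes
      have hmem (k : ℕ) (hk : 2 ≤ k) : varIdeal K (vertices I) ∈ Ass (I ^ k) := by
        rw [hAss k hk]
        exact Set.mem_insert _ _
      obtain ⟨ha, ha2⟩ := sInf_stable_eq_two (F := fun k => Ass (I ^ k))
        (fun k hk => (hAss k hk).trans (hAss 2 le_rfl).symm)
        fun h => hAss1 (h ▸ hmem 2 le_rfl)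
      obtain ⟨hd, hd2⟩ := sInf_stable_eq_two (F := fun k => depthQuot (I ^ k))
        (fun k hk => (hdepth k hk).trans (hdepth 2 le_rfl).symm)
        ((hdepth 2 le_rfl).trans_lt (hI.lt_depthQuot_of_loopless hloop hne)).ne'
      have ha2 : astab I = 2 := ha2
      have hd2 : dstab I = 2 := hd2
      refine ⟨⟨2, ha⟩, ⟨2, hd⟩, ha2.trans hd2.symm, fun h => ?_, fun _ =>
        ⟨1, ⟨hAss1, fun k hk => ?_⟩, ha2, hd2⟩⟩
      · rw [assInfty, ha2] at h
        exact absurd (hmem 2 le_rfl) h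
      · by_contra! hlt
        exact hk (hmem k hlt)
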